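/- **Setting.** Let $\mathcal I$ be a finite index set, let $(X_i,d)$, $i\in\mathcal I$, be nonempty complete metric spaces, and let $X=\prod_{i\in\mathcal I} X_i$ carry the maximum metric $d_{\max}$. A *dynamical network* $(\mathcal F,X)$ consists of maps $\varphi_i:X_i\to X_i$ with $$L_i=\sup_{x\neq y\in X_i}\frac{d(\varphi_i(x),\varphi_i(y))}{d(x,y)}<\infty$$ (with $L_i=0$ if $X_i$ is a single point), nonempty sets $\mathcal I_j\subseteq\mathcal I$, and continuous functions $F_j:\prod_{i\in\mathcal I_j}X_i\to X_j$, $j\in\mathcal I$; the map $\mathcal F:X\to X$ is $\mathcal F_j(\mathbf x)=F_j\big((\varphi_i(x_i))_{i\in\mathcal I_j}\big)$, so that $\mathcal F_j$ is a function of the variables $x_i$, $i\in\mathcal I_j$. The network is *globally stable* (has a *globally attracting fixed point*) if there is $\tilde{\mathbf x}\in X$ with $\mathcal F(\tilde{\mathbf x})=\tilde{\mathbf x}$ and $\lim_{k\to\infty}d_{\max}(\mathcal F^k(\mathbf x),\tilde{\mathbf x})=0$ for every $\mathbf x\in X$. A *stability matrix* of $(\mathcal F,X)$ is a matrix $A=\Lambda^T\,\mathrm{diag}(L_i)_{i\in\mathcal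 I}$ where $\Lambda_{ij}\ge 0$, $\Lambda_{ij}=0$ for $i\notin\mathcal I_j$, and $$d\big(F_j(\mathbf x|_{\mathcal I_j}),F_j(\mathbf y|_{\mathcal I_j})\big)\le\sum_{i\in\mathcal I_j}\Lambda_{ij}\,d(x_i,y_i)\qquad\text{for all }j\in\mathcal I,\ \mathbf x,\mathbf y\in X.$$ For a real square matrix $A$, $\rho(A)$ is the largest modulus of a complex eigenvalue of $A$. The *graph of interactions* $\Gamma_{\mathcal F}$ is the directed graph with vertex set $\mathcal I$ and an edge from $i$ to $j$ if and only if $i\in\mathcal I_j$. A *path* is a sequence $v_1,\dots,v_m$ of distinct vertices with an edge from each vertex to the next; a *cycle* is such a sequence with $m\ge2$ in which $v_1,\dots,v_{m-1}$ are distinct and $v_m=v_1$ (a loop is the cycle $v,v$). A set $S\subseteq\mathcal I$ is a *complete structural set* if every cycle contains a vertex of $S$ and every vertex belongs to a path or cycle that begins and ends with a vertex of $S$. A *branch* from $i\in S$ to $j\in S$ is a path or cycle from $i$ to $j$ with at least one edge and with no interior vertex in $S$. A complete structural set $S$ is *basic* if for all $i,j\in S$ (including $i=j$) there is at most one branch from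 $i$ to $j$. For a complete structural set $S$ the *restriction* $(\mathcal R_S\mathcal F,X|_S)$, where $X|_S=\prod_{i\in S}X_i$, is defined as follows. For $j\in S$ let $\mathcal F_{(j,0)}=\mathcal F_j$, and for $k\ge1$ let $\mathcal F_{(j,k)}$ be obtained from $\mathcal F_{(j,k-1)}$ by replacing each of its variables $x_\ell$ with $\ell\notin S$ by the function $\mathcal F_\ell$ (with its variables $x_i$, $i\in\mathcal I_\ell$). Since every cycle meets $S$, for some $k$ all variables of $\mathcal F_{(j,k)}$ have their index in $S$; $\mathcal R_S\mathcal F_j$ is $\mathcal F_{(j,k)}$ for the first such $k$. The restriction is regarded as a dynamical network on the index set $S$ without local dynamics, i.e. with all local maps equal to the identity and with interaction $\mathcal R_S\mathcal F=(\mathcal R_S\mathcal F_j)_{j\in S}$, the index set belonging to the component $j$ being the set of variables of $\mathcal R_S\mathcal F_j$. **Theorem 6.4.** Let $S$ be a basic structural set of $\Gamma_{\mathcal F}$. If $(\mathcal F,X)$ has a stability matrix $A$ with $\rho(A)<1$, then the restriction $(\mathcal R_S\mathcal F,X|_S)$ has a globally attracting fixed point. Conversely, if the restriction $(\mathcal R_S\mathcal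 F,X|_S)$ has a stability matrix $\tilde A$ with $\rho(\tilde A)<1$, then $(\mathcal F,X)$ has a globally attracting fixed point. -/

import Mathlib

open Filter Topology

noncomputable section

/-! ### Directed graphs: paths, cycles, branches, structural sets -/

/-- A path: a sequence `v₁, …, v_m` (`m ≥ 1`) of distinct vertices, consecutive ones joined by
edges. -/
def Digraph.IsVertexPath {ι : Type*} (G : Digraph ι) (l : List ι) : Prop :=
  l ≠ [] ∧ l.IsChain G.Adj ∧ l.Nodup

/-- A cycle: a sequence `v₁, …, v_m` (`m ≥ 2`), consecutive entries joined by edges, with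
`v_m = v₁` and `v₁, …, v_{m-1}` distinct.  A loop at `v` is the cycle `v, v`. -/
def Digraph.IsVertexCycle {ι : Type*} (G : Digraph ι) (l : List ι) : Prop :=
  2 ≤ l.length ∧ l.IsChain G.Adj ∧ l.dropLast.Nodup ∧ l.head? = l.getLast?

/-- Every cycle contains a vertex of `S`, and every vertex of the graph belongs to a path or cycle
that begins and ends in `S`. -/
structure Digraph.IsCompleteStructuralSet {ι : Type*} (G : Digraph ι) (S : Finset ι) : Prop where
  meets_cycle : ∀ l, G.IsVertexCycle l → ∃ v ∈ l, v ∈ S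
  covers : ∀ v, ∃ l, (G.IsVertexPath l ∨ G.IsVertexCycle l) ∧ v ∈ l ∧
    (∃ i ∈ S, l.head? = some i) ∧ (∃ j ∈ S, l.getLast? = some j)

/-- The branches from `i` to `j` with respect to `S`: the paths and cycles (with at least one edge)
from `i` to `j` that have no interior vertex in `S`. -/
def Digraph.branches {ι : Type*} (G : Digraph ι) (S : Finset ι) (i j : ι) : Set (List ι) :=
  {l | (G.IsVertexPath l ∨ G.IsVertexCycle l) ∧ 2 ≤ l.length ∧
    l.head? = some i ∧ l.getLast? = some j ∧ ∀ v ∈ l.tail.dropLast, v ∉ S}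

/-- A complete structural set with at most one branch between any two of its vertices
(in each direction, the two vertices being allowed to coincide). -/
structure Digraph.IsBasicStructuralSet {ι : Type*} (G : Digraph ι) (S : Finset ι) : Prop where
  complete : G.IsCompleteStructuralSet S
  branches_le_one : ∀ i ∈ S, ∀ j ∈ S, (G.branches S i j).encard ≤ 1

theorem Digraph.exists_cycle_of_not_nodup {ι : Type*} (G : Digraph ι) (l : List ι)
    (hc : l.IsChain G.Adj) (hn : ¬ l.Nodup) : ∃ c, G.IsVertexCycle c ∧ ∀ v ∈ c, v ∈ l := by
  induction l with
  | nil => simp at hn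
  | cons a t ih =>
    by_cases ht : t.Nodup
    · have ha : a ∈ t := by
        by_contra h
        exact hn (List.nodup_cons.2 ⟨h, ht⟩)
      obtain ⟨p, q, rfl⟩ := List.append_of_mem ha
      refine ⟨(a :: p) ++ [a], ⟨by simp, ?_, ?_, by rw [List.getLast?_concat]; rfl⟩, ?_⟩
      · have e : a :: (p ++ a :: q) = ((a :: p) ++ [a]) ++ q := by simp
        rw [e] at hc
        exact hc.left_of_append
      · rw [List.dropLast_concat]
        have := List.nodup_append.1 ht
        refine List.nodup_cons.2 ⟨fun h => ?_, this.1⟩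
        exact this.2.2 a h a (by simp) rfl
      · intro v hv
        simp only [List.cons_append, List.mem_cons, List.mem_append, List.not_mem_nil,
          or_false] at hv ⊢
        tauto
    · obtain ⟨c, h1, h2⟩ := ih hc.tail ht
      exact ⟨c, h1, fun v hv => List.mem_cons_of_mem _ (h2 v hv)⟩

/-! ### Dynamical networks -/

/-- A dynamical network on the metric spaces `X i`: Lipschitz local maps `φ i : X i → X i` and an
interaction, whose `j`-th component is a continuous function `F j` of the coordinates with index in
the nonempty set `I j`. -/
structure DynamicalNetwork {ι : Type*} (X : ι → Type*) [∀ i, MetricSpace (X i)] where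
  φ : ∀ i, X i → X i
  lipschitz : ∀ i, ∃ K, LipschitzWith K (φ i)
  I : ι → Finset ι
  I_nonempty : ∀ j, (I j).Nonempty
  F : ∀ j, (∀ i : I j, X i) → X j
  continuous_F : ∀ j, Continuous (F j)

/-- A continuous function of finitely many of the variables `x i`, together with the set of its
variables. -/
structure VarFun {ι : Type*} (X : ι → Type*) [∀ i, MetricSpace (X i)] (Y : Type*)
    [MetricSpace Y] where
  vars : Finset ι
  toFun : (∀ i : vars, X i) → Y
  vars_nonempty : vars.Nonempty
  continuous_toFun : Continuous toFun

namespace DynamicalNetwork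

variable {ι : Type*} {X : ι → Type*} [∀ i, MetricSpace (X i)]

theorem continuous_φ (N : DynamicalNetwork X) (i : ι) : Continuous (N.φ i) :=
  (N.lipschitz i).choose_spec.continuous

/-- The `j`-th component of `𝓕 = F ∘ φ`, as a function of the variables with index in `I j`. -/
def component (N : DynamicalNetwork X) (j : ι) : VarFun X (X j) where
  vars := N.I j
  toFun x := N.F j fun i => N.φ i (x i)
  vars_nonempty := N.I_nonempty j
  continuous_toFun := by
    have := N.continuous_F j
    have := N.continuous_φ
    fun_prop

/-- The map `𝓕 = F ∘ φ` on the product space. -/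
def map (N : DynamicalNetwork X) (x : ∀ i, X i) : ∀ i, X i :=
  fun j => (N.component j).toFun fun i => x i

/-- The graph of interactions: there is an edge from `i` to `j` iff `i ∈ I j`. -/
def graph (N : DynamicalNetwork X) : Digraph ι := ⟨fun i j => i ∈ N.I j⟩

/-- The optimal Lipschitz constant of the local map `φ i` (it is `0` on a one-point space). -/
def localLip (N : DynamicalNetwork X) (i : ι) : ℝ :=
  sSup {r | ∃ x y : X i, x ≠ y ∧ r = dist (N.φ i x) (N.φ i y) / dist x y}

/-- `A = Λᵀ diag(L)`, where `L i` is the Lipschitz constant of `φ i` and the nonnegative numbers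
`Λ i j`, vanishing for `i ∉ I j`, are Lipschitz constants of the interaction `F`. -/
def IsStabilityMatrix [Fintype ι] [DecidableEq ι] (N : DynamicalNetwork X)
    (A : Matrix ι ι ℝ) : Prop :=
  ∃ Λ : Matrix ι ι ℝ, (∀ i j, 0 ≤ Λ i j) ∧ (∀ i j, i ∉ N.I j → Λ i j = 0) ∧
    (∀ j, ∀ x y : (∀ i, X i),
      dist (N.F j fun i => x i) (N.F j fun i => y i) ≤ ∑ i ∈ N.I j, Λ i j * dist (x i) (y i)) ∧
    A = Λ.transpose * Matrix.diagonal N.localLip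

/-- The network has a globally attracting fixed point.  The product space carries the maximum
metric. -/
def IsGloballyStable [Fintype ι] (N : DynamicalNetwork X) : Prop :=
  ∃ p : ∀ i, X i, N.map p = p ∧
    ∀ x, Tendsto (fun k : ℕ => dist (N.map^[k] x) p) atTop (𝓝 0)

variable [DecidableEq ι]

/-- One substitution step: in `g`, each variable `x ℓ` with `ℓ ∉ S` is replaced by the function
`𝓕_ℓ` of the variables with index in `I ℓ`. -/
def subst (N : DynamicalNetwork X) (S : Finset ι) {Y : Type*} [MetricSpace Y]
    (g : VarFun X Y) : VarFun X Y where
  vars := g.vars.biUnion fun l => if l ∈ S then {l} else (N.component l).vars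
  toFun x := g.toFun fun l =>
    if h : (l : ι) ∈ S then
      x ⟨l, Finset.mem_biUnion.2 ⟨l, l.2, by simp [h]⟩⟩
    else
      (N.component l).toFun fun i =>
        x ⟨i, Finset.mem_biUnion.2 ⟨l, l.2, by rw [if_neg h]; exact i.2⟩⟩
  vars_nonempty := by
    obtain ⟨l, hl⟩ := g.vars_nonempty
    by_cases h : l ∈ S
    · exact ⟨l, Finset.mem_biUnion.2 ⟨l, hl, by simp [h]⟩⟩
    · obtain ⟨i, hi⟩ := (N.component l).vars_nonempty
      exact ⟨i, Finset.mem_biUnion.2 ⟨l, hl, by rw [if_neg h]; exact hi⟩⟩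
  continuous_toFun := by
    refine g.continuous_toFun.comp (continuous_pi fun l => ?_)
    by_cases h : (l : ι) ∈ S
    · simp only [h, dif_pos]
      fun_prop
    · simp only [h, dif_neg, not_false_eq_true]
      exact (N.component l).continuous_toFun.comp (by fun_prop)

/-- The function `𝓕_(j,k)`, obtained from `𝓕_j` by `k` substitution steps. -/
def substIter (N : DynamicalNetwork X) (S : Finset ι) (j : ι) (k : ℕ) : VarFun X (X j) :=
  (N.subst S)^[k] (N.component j)

theorem substIter_walk (N : DynamicalNetwork X) (S : Finset ι) (j : ι) (k : ℕ) :
    ∀ i ∈ (N.substIter S j k).vars, i ∉ S →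
      ∃ l : List ι, l.head? = some i ∧ l.length = k + 1 ∧ l.IsChain N.graph.Adj ∧
        ∀ v ∈ l, v ∉ S := by
  induction k with
  | zero => exact fun i _ hi => ⟨[i], by simp, by simp, by simp, by simpa using hi⟩
  | succ k ih =>
    intro i hi hiS
    rw [substIter, Function.iterate_succ_apply'] at hi
    obtain ⟨m, hm, him⟩ := Finset.mem_biUnion.1 hi
    by_cases h : m ∈ S
    · rw [if_pos h, Finset.mem_singleton] at him
      exact absurd (him ▸ h) hiS
    · rw [if_neg h] at him
      obtain ⟨l, h1, h2, h3, h4⟩ := ih m hm h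
      refine ⟨i :: l, by simp, by simp [h2], ?_, ?_⟩
      · refine List.isChain_cons.2 ⟨?_, h3⟩
        intro y hy
        rw [h1, Option.mem_some_iff] at hy
        exact hy ▸ him
      · intro v hv
        rcases List.mem_cons.1 hv with rfl | hv
        exacts [hiS, h4 v hv]

/-- If every cycle meets `S` then the substitution procedure terminates. -/
theorem exists_substIter_vars_subset [Fintype ι] (N : DynamicalNetwork X) (S : Finset ι)
    (hS : N.graph.IsCompleteStructuralSet S) (j : ι) :
    ∃ k, (N.substIter S j k).vars ⊆ S := by
  refine ⟨Fintype.card ι, fun i hi => ?_⟩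
  by_contra hiS
  obtain ⟨l, -, h2, h3, h4⟩ := N.substIter_walk S j _ i hi hiS
  have hn : ¬ l.Nodup := fun h => by
    have := h.length_le_card
    omega
  obtain ⟨c, hc, hcl⟩ := N.graph.exists_cycle_of_not_nodup l h3 hn
  obtain ⟨v, hv, hvS⟩ := hS.meets_cycle c hc
  exact h4 v (hcl v hv) hvS

/-- The component `R_S 𝓕_j`: the first of the functions `𝓕_(j,0), 𝓕_(j,1), …` all of whose variables
have their index in `S`. -/
def restrictionComponent [Fintype ι] (N : DynamicalNetwork X) (S : Finset ι)
    (hS : N.graph.IsCompleteStructuralSet S) (j : ι) : VarFun X (X j) :=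
  N.substIter S j (Nat.find (N.exists_substIter_vars_subset S hS j))

theorem restrictionComponent_vars_subset [Fintype ι] (N : DynamicalNetwork X) (S : Finset ι)
    (hS : N.graph.IsCompleteStructuralSet S) (j : ι) :
    (N.restrictionComponent S hS j).vars ⊆ S :=
  Nat.find_spec (N.exists_substIter_vars_subset S hS j)

/-- The restriction `(R_S 𝓕, X|_S)`, as a network without local dynamics (`φ = id`). -/
def restriction [Fintype ι] (N : DynamicalNetwork X) (S : Finset ι)
    (hS : N.graph.IsCompleteStructuralSet S) :
    DynamicalNetwork (fun i : {i // i ∈ S} => X i) where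
  φ _ := id
  lipschitz _ := ⟨1, LipschitzWith.id⟩
  I j := (N.restrictionComponent S hS j).vars.subtype (· ∈ S)
  I_nonempty j := by
    obtain ⟨i, hi⟩ := (N.restrictionComponent S hS j).vars_nonempty
    exact ⟨⟨i, N.restrictionComponent_vars_subset S hS j hi⟩, Finset.mem_subtype.2 hi⟩
  F j x := (N.restrictionComponent S hS j).toFun fun i =>
    x ⟨⟨i, N.restrictionComponent_vars_subset S hS j i.2⟩, Finset.mem_subtype.2 i.2⟩
  continuous_F j := by
    refine (N.restrictionComponent S hS j).continuous_toFun.comp ?_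
    exact continuous_pi fun i => continuous_apply _

end DynamicalNetwork

/-- The spectral radius of a real square matrix: the largest modulus of a complex eigenvalue. -/
def Matrix.complexSpectralRadius {ι : Type*} [Fintype ι] [DecidableEq ι] (A : Matrix ι ι ℝ) :
    ENNReal :=
  spectralRadius ℂ (A.map Complex.ofReal)

end

/-! ### Positive vectors contracted by a nonnegative matrix -/

/-! A nonnegative matrix with `ρ(A) < 1` has a positive vector `w` and `r < 1` with `A w ≤ r w`
(`Matrix.exists_pos_mulVec_le`), so a network with such a stability matrix contracts a weighted
maximum metric.

Restricting preserves this: `R_S 𝓕_j` is `𝓕_j` applied after finitely many updates of the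
coordinates outside `S`; the updates do not expand the weighted distance and the last application
contracts it (`isWeightedContraction_restriction`). A Banach-type argument then gives the attracting
fixed point.

Conversely, since `S` is basic, each variable `x i` enters `R_S 𝓕_j` along a single branch, so for
large `t` a trajectory satisfies `x_j(t) = R_S 𝓕_j` of the values `x_i(t - b i j)`, with `b i j` the
branch length (`map_iterate_eq_restriction_map`). Bounded positive delays only slow a contraction
down, so coordinates in `S` converge to the fixed point of the restriction. The others follow by
continuity, as no cycle avoids `S`. -/

theorem Matrix.exists_pow_row_sum_le {ι : Type*} [Fintype ι] [DecidableEq ι]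
    (A : Matrix ι ι ℝ) (hA : A.complexSpectralRadius < 1) :
    ∃ r : ℝ, 0 < r ∧ r < 1 ∧ ∃ n : ℕ, 0 < n ∧ ∀ i, ∑ j, (A ^ n) i j ≤ r ^ n := by
  let _ : NormedRing (Matrix ι ι ℂ) := Matrix.linftyOpNormedRing
  let _ : NormedAlgebra ℂ (Matrix ι ι ℂ) := Matrix.linftyOpNormedAlgebra
  have _ : CompleteSpace (Matrix ι ι ℂ) := FiniteDimensional.complete ℂ _
  obtain ⟨r, hr, hr1⟩ := ENNReal.lt_iff_exists_nnreal_btwn.1 hA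
  have hr0 : 0 < r := by
    have := lt_of_le_of_lt (zero_le) hr
    exact_mod_cast this
  -- Gelfand's formula, in the operator norm equal to the largest absolute row sum.
  have h := spectrum.pow_nnnorm_pow_one_div_tendsto_nhds_spectralRadius
    (A.map Complex.ofReal)
  obtain ⟨n, hn, hn1⟩ := ((h.eventually (gt_mem_nhds hr)).and (eventually_ge_atTop 1)).exists
  refine ⟨r, hr0, by exact_mod_cast hr1, n, hn1, fun i => ?_⟩
  have hle : ‖A.map Complex.ofReal ^ n‖₊ ≤ r ^ n := by
    have h1 := ENNReal.rpow_le_rpow hn.le (z := (n : ℝ)) (by positivity)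
    rw [← ENNReal.rpow_mul, one_div_mul_cancel (by positivity), ENNReal.rpow_one,
      ENNReal.rpow_natCast] at h1
    exact_mod_cast h1
  have hpow : A.map Complex.ofReal ^ n = (A ^ n).map Complex.ofReal :=
    (Matrix.map_pow A Complex.ofRealHom n).symm
  rw [hpow, Matrix.linfty_opNNNorm_def] at hle
  have h2 := (Finset.le_sup (f := fun i => ∑ j, ‖(A ^ n).map Complex.ofReal i j‖₊)
    (Finset.mem_univ i)).trans hle
  have h3 : ∑ j, ‖(A ^ n) i j‖ ≤ (r : ℝ) ^ n := by
    have := NNReal.coe_le_coe.2 h2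
    push_cast at this
    simpa using this
  exact (Finset.sum_le_sum fun j _ => Real.le_norm_self _).trans h3

theorem Matrix.exists_pos_mulVec_le {ι : Type*} [Fintype ι] [DecidableEq ι]
    (A : Matrix ι ι ℝ) (hA0 : ∀ i j, 0 ≤ A i j) (hA : A.complexSpectralRadius < 1) :
    ∃ (w : ι → ℝ) (r : ℝ), (∀ i, 0 < w i) ∧ 0 < r ∧ r < 1 ∧
      ∀ i, ∑ j, A i j * w j ≤ r * w i := by
  obtain ⟨r, hr0, hr1, n, hnpos, hn⟩ := A.exists_pow_row_sum_le hA
  have hrow : ∀ k i, 0 ≤ ∑ j, (A ^ k) i j := by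
    intro k
    have : ∀ i j, 0 ≤ (A ^ k) i j := by
      induction k with
      | zero =>
        intro i j
        rw [pow_zero, Matrix.one_apply]
        split_ifs <;> norm_num
      | succ k ih =>
        intro i j
        rw [pow_succ, Matrix.mul_apply]
        exact Finset.sum_nonneg fun l _ => mul_nonneg (ih i l) (hA0 l j)
    exact fun i => Finset.sum_nonneg fun j _ => this i j
  have hstep : ∀ k i, ∑ j, A i j * ∑ l, (A ^ k) j l = ∑ l, (A ^ (k + 1)) i l := by
    intro k i
    simp_rw [pow_succ', Matrix.mul_apply, Finset.mul_sum]
    exact Finset.sum_comm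
  -- With `f k = r⁻ᵏ Aᵏ 1` one has `A (f k) = r f (k+1)`. For `w = ∑_{k<n} f k` this telescopes to
  -- `A w = r (w + f n - f 0)`, and `f n ≤ 1 = f 0`.
  let f : ℕ → ι → ℝ := fun k i => (r ^ k)⁻¹ * ∑ j, (A ^ k) i j
  have hf0 : ∀ i, f 0 i = 1 := fun i => by simp [f, Matrix.one_apply]
  have hfn : ∀ i, f n i ≤ 1 := fun i => by
    have := pow_pos hr0 n
    simp only [f]
    rw [inv_mul_le_iff₀ this, mul_one]
    exact hn i
  have hfs : ∀ k i, ∑ j, A i j * f k j = r * f (k + 1) i := by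
    intro k i
    simp only [f]
    rw [← hstep, Finset.mul_sum, Finset.mul_sum]
    refine Finset.sum_congr rfl fun j _ => ?_
    rw [pow_succ]
    field_simp
  have hfnn : ∀ k i, 0 ≤ f k i := fun k i =>
    mul_nonneg (inv_nonneg.2 (pow_pos hr0 k).le) (hrow k i)
  have key : ∀ m, ∀ i, ∑ j, A i j * ∑ k ∈ Finset.range m, f k j
      = r * (∑ k ∈ Finset.range m, f k i + f m i - f 0 i) := by
    intro m i
    rw [← Finset.sum_range_succ, Finset.sum_range_succ', add_sub_cancel_right, Finset.mul_sum]
    simp_rw [Finset.mul_sum]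
    rw [Finset.sum_comm]
    exact Finset.sum_congr rfl fun k _ => hfs k i
  refine ⟨fun i => ∑ k ∈ Finset.range n, f k i, r, fun i => ?_, hr0, hr1, fun i => ?_⟩
  · refine lt_of_lt_of_le ?_ (Finset.single_le_sum (fun k _ => hfnn k i)
      (Finset.mem_range.2 hnpos))
    rw [hf0]
    exact one_pos
  · rw [key n i, hf0]
    have := hfn i
    exact mul_le_mul_of_nonneg_left (by linarith) hr0.le

/-! ### Contractions in a weighted maximum metric -/

/-- `f` contracts the weighted maximum metric `sup_i d(x_i, y_i) / w_i` by the factor `r`. -/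
def IsWeightedContraction {ι : Type*} {X : ι → Type*} [∀ i, MetricSpace (X i)]
    (f : (∀ i, X i) → ∀ i, X i) (w : ι → ℝ) (r : ℝ) : Prop :=
  ∀ (x y : ∀ i, X i) (c : ℝ), (∀ i, dist (x i) (y i) ≤ c * w i) →
    ∀ j, dist (f x j) (f y j) ≤ r * (c * w j)

theorem exists_dist_le_mul_weight {ι : Type*} [Finite ι] {X : ι → Type*}
    [∀ i, MetricSpace (X i)] {w : ι → ℝ} (hw : ∀ i, 0 < w i) (x y : ∀ i, X i) :
    ∃ c, ∀ i, dist (x i) (y i) ≤ c * w i := by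
  obtain ⟨c, hc⟩ := Finite.exists_le fun i => dist (x i) (y i) / w i
  exact ⟨c, fun i => (div_le_iff₀ (hw i)).1 (hc i)⟩

namespace IsWeightedContraction

variable {ι : Type*} {X : ι → Type*} [∀ i, MetricSpace (X i)]
  {f : (∀ i, X i) → ∀ i, X i} {w : ι → ℝ} {r : ℝ}

theorem dist_iterate_le (hf : IsWeightedContraction f w r) {x y : ∀ i, X i} {c : ℝ}
    (h : ∀ i, dist (x i) (y i) ≤ c * w i) (n : ℕ) (i : ι) :
    dist (f^[n] x i) (f^[n] y i) ≤ c * w i * r ^ n := by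
  induction n generalizing i with
  | zero => simpa using h i
  | succ n ih =>
    rw [Function.iterate_succ_apply', Function.iterate_succ_apply']
    refine (hf _ _ (c * r ^ n) (fun i => (ih i).trans_eq (by ring)) i).trans_eq ?_
    ring

theorem exists_fixedPoint [Finite ι] [∀ i, CompleteSpace (X i)] [∀ i, Nonempty (X i)]
    (hf : IsWeightedContraction f w r) (hw : ∀ i, 0 < w i) (hr0 : 0 < r) (hr1 : r < 1) :
    ∃ p, f p = p := by
  let x : ∀ i, X i := fun i => Classical.arbitrary (X i)
  obtain ⟨c, hc⟩ := exists_dist_le_mul_weight hw x (f x)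
  have hstep : ∀ i n, dist (f^[n] x i) (f^[n + 1] x i) ≤ c * w i * r ^ n := fun i n => by
    rw [Function.iterate_succ_apply]
    exact hf.dist_iterate_le hc n i
  choose p hp using fun i => cauchySeq_tendsto_of_complete
    (cauchySeq_of_le_geometric r (c * w i) hr1 (hstep i))
  refine ⟨p, funext fun i => ?_⟩
  -- A common multiple of the weights, so that the contraction hypothesis applies to `f^[n] x` and
  -- `p`; this replaces continuity of `f`.
  have hb : ∀ n i, dist (f^[n] x i) (p i) ≤ (c * r ^ n / (1 - r)) * w i := fun n i =>
    (dist_le_of_le_geometric_of_tendsto r (c * w i) hr1 (hstep i) (hp i) n).trans_eq (by ring)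
  have hb' : ∀ n, dist (f^[n + 1] x i) (f p i) ≤ r * (c * r ^ n / (1 - r) * w i) := fun n => by
    rw [Function.iterate_succ_apply']
    exact hf _ _ _ (hb n) i
  have hlim : Tendsto (fun n => r * (c * r ^ n / (1 - r) * w i)) atTop (𝓝 0) := by
    have := ((((tendsto_pow_atTop_nhds_zero_of_lt_one hr0.le hr1).const_mul c).div_const
      (1 - r)).mul_const (w i)).const_mul r
    simpa using this
  have h1 : Tendsto (fun n => f^[n + 1] x i) atTop (𝓝 (f p i)) :=
    tendsto_iff_dist_tendsto_zero.2 (squeeze_zero (fun _ => dist_nonneg) hb' hlim)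
  exact tendsto_nhds_unique h1 ((tendsto_add_atTop_iff_nat 1).2 (hp i))

theorem tendsto_iterate [Fintype ι] (hf : IsWeightedContraction f w r) (hw : ∀ i, 0 < w i)
    (hr0 : 0 < r) (hr1 : r < 1) {p : ∀ i, X i} (hp : f p = p) (x : ∀ i, X i) :
    Tendsto (fun k : ℕ => f^[k] x) atTop (𝓝 p) := by
  obtain ⟨c, hc⟩ := exists_dist_le_mul_weight hw x p
  refine tendsto_pi_nhds.2 fun i => tendsto_iff_dist_tendsto_zero.2 ?_
  refine squeeze_zero (fun _ => dist_nonneg) (fun n => ?_)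
    (by simpa using (tendsto_pow_atTop_nhds_zero_of_lt_one hr0.le hr1).const_mul (c * w i))
  simpa only [Function.iterate_fixed hp] using hf.dist_iterate_le hc n i

end IsWeightedContraction

/-! ### Branches -/

namespace Digraph

variable {ι : Type*} {G : Digraph ι} {S : Finset ι}

/-- A repeated interior vertex would produce a cycle avoiding `S`, and the endpoints, lying in `S`,
differ from all interior vertices. -/
theorem IsCompleteStructuralSet.mem_branches (hS : G.IsCompleteStructuralSet S) {i j : ι}
    (hi : i ∈ S) (hj : j ∈ S) {l : List ι} (hl : ∀ v ∈ l, v ∉ S)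
    (hc : (i :: (l ++ [j])).IsChain G.Adj) : i :: (l ++ [j]) ∈ G.branches S i j := by
  have hnd : l.Nodup := by
    by_contra hn
    obtain ⟨c, hcyc, hcl⟩ := G.exists_cycle_of_not_nodup l hc.tail.left_of_append hn
    obtain ⟨v, hv, hvS⟩ := hS.meets_cycle c hcyc
    exact hl v (hcl v hv) hvS
  have hil : i ∉ l := fun h => hl i h hi
  have hjl : j ∉ l := fun h => hl j h hj
  have hlast : (i :: (l ++ [j])).getLast? = some j := by
    rw [← List.cons_append, List.getLast?_concat]
  refine ⟨?_, by simp, rfl, hlast, by simpa using hl⟩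
  by_cases hij : i = j
  · refine Or.inr ⟨by simp, hc, ?_, by rw [hlast, hij]; rfl⟩
    rw [← List.cons_append, List.dropLast_concat]
    exact List.nodup_cons.2 ⟨hil, hnd⟩
  · refine Or.inl ⟨by simp, hc, List.nodup_cons.2 ⟨?_, ?_⟩⟩
    · simp [hil, hij]
    · rw [List.nodup_append]
      refine ⟨hnd, by simp, ?_⟩
      rintro a ha b hb rfl
      exact hjl (List.mem_singleton.1 hb ▸ ha)

open Classical in
/-- The number of edges of a branch from `i` to `j` (and `1` if there is none). -/
noncomputable def branchLength (G : Digraph ι) (S : Finset ι) (i j : ι) : ℕ :=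
  if h : (G.branches S i j).Nonempty then h.some.length - 1 else 1

/-- The default value `1` makes every delay positive, so delayed times are strictly earlier even for
pairs without a branch. -/
theorem branchLength_pos (i j : ι) : 0 < G.branchLength S i j := by
  unfold branchLength
  split_ifs with h
  · have := h.some_mem.2.1
    omega
  · exact one_pos

/-- Uniqueness of branches enters here: the delay does not depend on the branch chosen. -/
theorem IsBasicStructuralSet.branchLength_eq (hS : G.IsBasicStructuralSet S) {i j : ι}
    (hi : i ∈ S) (hj : j ∈ S) {l : List ι} (hl : l ∈ G.branches S i j) :
    G.branchLength S i j = l.length - 1 := by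
  have h : (G.branches S i j).Nonempty := ⟨l, hl⟩
  rw [branchLength, dif_pos h,
    Set.encard_le_one_iff.1 (hS.branches_le_one i hi j hj) _ _ h.some_mem hl]

end Digraph

-- The values outside `S` do not depend on `x`, so two extensions are at distance zero there.
open Classical in
theorem exists_extension {ι : Type*} {X : ι → Type*} [∀ i, Nonempty (X i)] (S : Finset ι) (x : ∀ i : {i // i ∈ S}, X i) :
    ∃ x' : ∀ i, X i, (∀ i : {i // i ∈ S}, x' i = x i) ∧
      ∀ i ∉ S, x' i = Classical.arbitrary (X i) :=
  ⟨fun i => if h : i ∈ S then x ⟨i, h⟩ else Classical.arbitrary (X i), fun i => by simp,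
    fun i hi => by simp [hi]⟩

namespace VarFun

variable {ι : Type*} {X : ι → Type*} [∀ i, MetricSpace (X i)] {Y : Type*} [MetricSpace Y]

/-- The value of a function of finitely many variables at a point of the full product. -/
def eval (g : VarFun X Y) (x : ∀ i, X i) : Y := g.toFun fun i => x i

theorem eval_congr (g : VarFun X Y) {x y : ∀ i, X i} (h : ∀ i ∈ g.vars, x i = y i) :
    g.eval x = g.eval y :=
  congrArg g.toFun (funext fun i => h i i.2)

end VarFun

namespace DynamicalNetwork

variable {ι : Type*} {X : ι → Type*} [∀ i, MetricSpace (X i)]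

/-! ### Stability matrices give weighted contractions -/

theorem localLip_nonneg (N : DynamicalNetwork X) (i : ι) : 0 ≤ N.localLip i := by
  refine Real.sSup_nonneg ?_
  rintro _ ⟨x, y, -, rfl⟩
  positivity

theorem dist_φ_le (N : DynamicalNetwork X) (i : ι) (x y : X i) :
    dist (N.φ i x) (N.φ i y) ≤ N.localLip i * dist x y := by
  by_cases hxy : x = y
  · simp [hxy]
  have hpos : 0 < dist x y := dist_pos.2 hxy
  rw [← div_le_iff₀ hpos]
  obtain ⟨K, hK⟩ := N.lipschitz i
  refine le_csSup ⟨K, ?_⟩ ⟨x, y, hxy, rfl⟩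
  rintro _ ⟨a, b, hab, rfl⟩
  exact (div_le_iff₀ (dist_pos.2 hab)).2 (hK.dist_le_mul a b)

theorem IsStabilityMatrix.nonneg [Fintype ι] [DecidableEq ι] {N : DynamicalNetwork X}
    {A : Matrix ι ι ℝ} (hA : N.IsStabilityMatrix A) (i j : ι) : 0 ≤ A i j := by
  obtain ⟨Λ, h0, -, -, rfl⟩ := hA
  rw [Matrix.mul_diagonal]
  exact mul_nonneg (h0 _ _) (N.localLip_nonneg _)

theorem IsStabilityMatrix.dist_map_le [Fintype ι] [DecidableEq ι] {N : DynamicalNetwork X}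
    {A : Matrix ι ι ℝ} (hA : N.IsStabilityMatrix A) (x y : ∀ i, X i) (j : ι) :
    dist (N.map x j) (N.map y j) ≤ ∑ i, A j i * dist (x i) (y i) := by
  obtain ⟨Λ, h0, hI, hF, rfl⟩ := hA
  refine (hF j (fun i => N.φ i (x i)) fun i => N.φ i (y i)).trans ?_
  rw [Finset.sum_subset (Finset.subset_univ (N.I j))
    fun i _ hi => by rw [hI i j hi, zero_mul]]
  refine Finset.sum_le_sum fun i _ => ?_
  rw [Matrix.mul_diagonal, Matrix.transpose_apply, mul_assoc]
  exact mul_le_mul_of_nonneg_left (N.dist_φ_le i _ _) (h0 i j)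

theorem IsStabilityMatrix.exists_isWeightedContraction [Fintype ι] [DecidableEq ι]
    {N : DynamicalNetwork X} {A : Matrix ι ι ℝ} (hA : N.IsStabilityMatrix A)
    (hρ : A.complexSpectralRadius < 1) :
    ∃ (w : ι → ℝ) (r : ℝ), (∀ i, 0 < w i) ∧ 0 < r ∧ r < 1 ∧
      IsWeightedContraction N.map w r := by
  obtain ⟨w, r, hw, hr0, hr1, h⟩ := A.exists_pos_mulVec_le hA.nonneg hρ
  refine ⟨w, r, hw, hr0, hr1, fun x y c hc j => (hA.dist_map_le x y j).trans ?_⟩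
  have hc0 : 0 ≤ c := nonneg_of_mul_nonneg_left (dist_nonneg.trans (hc j)) (hw j)
  calc ∑ i, A j i * dist (x i) (y i) ≤ ∑ i, A j i * (c * w i) :=
        Finset.sum_le_sum fun i _ => mul_le_mul_of_nonneg_left (hc i) (hA.nonneg j i)
    _ = c * ∑ i, A j i * w i := by
        rw [Finset.mul_sum]
        exact Finset.sum_congr rfl fun i _ => by ring
    _ ≤ c * (r * w j) := mul_le_mul_of_nonneg_left (h j) hc0
    _ = r * (c * w j) := by ring

theorem eval_component (N : DynamicalNetwork X) (j : ι) (x : ∀ i, X i) :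
    (N.component j).eval x = N.map x j :=
  rfl

theorem continuous_map (N : DynamicalNetwork X) : Continuous N.map :=
  continuous_pi fun j => (N.component j).continuous_toFun.comp (by fun_prop)

theorem isGloballyStable_of_isWeightedContraction [Fintype ι] [∀ i, CompleteSpace (X i)]
    [∀ i, Nonempty (X i)] (N : DynamicalNetwork X) {w : ι → ℝ} {r : ℝ} (hw : ∀ i, 0 < w i)
    (hr0 : 0 < r) (hr1 : r < 1) (h : IsWeightedContraction N.map w r) :
    N.IsGloballyStable := by
  obtain ⟨p, hp⟩ := h.exists_fixedPoint hw hr0 hr1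
  exact ⟨p, hp, fun x => tendsto_iff_dist_tendsto_zero.1 (h.tendsto_iterate hw hr0 hr1 hp x)⟩

/-! ### Evaluating the restriction -/

variable [DecidableEq ι]

/-- Update the coordinates outside `S` by the map of the network. -/
def updateOff (N : DynamicalNetwork X) (S : Finset ι) (x : ∀ i, X i) : ∀ i, X i :=
  fun l => if l ∈ S then x l else N.map x l

theorem eval_subst (N : DynamicalNetwork X) (S : Finset ι) {Y : Type*} [MetricSpace Y]
    (g : VarFun X Y) (x : ∀ i, X i) :
    (N.subst S g).eval x = g.eval (N.updateOff S x) := by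
  refine congrArg g.toFun (funext fun l => ?_)
  by_cases h : (l : ι) ∈ S
  · simp [updateOff, h]
  · simp [updateOff, h, map]

theorem substIter_succ (N : DynamicalNetwork X) (S : Finset ι) (j : ι) (k : ℕ) :
    N.substIter S j (k + 1) = N.subst S (N.substIter S j k) :=
  Function.iterate_succ_apply' _ _ _

theorem mem_vars_substIter_succ (N : DynamicalNetwork X) (S : Finset ι) (j : ι) (k : ℕ) (i : ι) :
    i ∈ (N.substIter S j (k + 1)).vars ↔
      ∃ l ∈ (N.substIter S j k).vars, if l ∈ S then i = l else i ∈ N.I l := by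
  rw [substIter_succ]
  refine Finset.mem_biUnion.trans (exists_congr fun l => and_congr_right fun _ => ?_)
  split_ifs
  · exact Finset.mem_singleton
  · rfl

/-- Turns formal substitution into dynamics: each substitution step is precomposition with
`updateOff`. -/
theorem eval_substIter (N : DynamicalNetwork X) (S : Finset ι) (j : ι) (k : ℕ) (x : ∀ i, X i) :
    (N.substIter S j k).eval x = N.map ((N.updateOff S)^[k] x) j := by
  induction k generalizing x with
  | zero => rfl
  | succ k ih => rw [substIter_succ, eval_subst, ih, Function.iterate_succ_apply]

theorem restriction_map_apply [Fintype ι] (N : DynamicalNetwork X) {S : Finset ι}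
    (hS : N.graph.IsCompleteStructuralSet S) (x : ∀ i, X i) (j : {i // i ∈ S}) :
    (N.restriction S hS).map (fun i => x i) j = (N.restrictionComponent S hS j).eval x :=
  rfl

/-! ### Stability of the restriction -/

theorem isWeightedContraction_restriction [Fintype ι] [∀ i, Nonempty (X i)]
    (N : DynamicalNetwork X) {S : Finset ι} (hS : N.graph.IsCompleteStructuralSet S)
    {w : ι → ℝ} {r : ℝ} (hw : ∀ i, 0 < w i) (hr1 : r < 1)
    (h : IsWeightedContraction N.map w r) :
    IsWeightedContraction (N.restriction S hS).map (fun i => w i) r := by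
  intro x y c hc j
  have hc0 : 0 ≤ c := nonneg_of_mul_nonneg_left (dist_nonneg.trans (hc j)) (hw j)
  obtain ⟨x', hx, hx'⟩ := exists_extension S x
  obtain ⟨y', hy, hy'⟩ := exists_extension S y
  obtain rfl : (fun i : {i // i ∈ S} => x' i) = x := funext hx
  obtain rfl : (fun i : {i // i ∈ S} => y' i) = y := funext hy
  rw [restriction_map_apply, restriction_map_apply, restrictionComponent, eval_substIter,
    eval_substIter]
  have h0 : ∀ i, dist (x' i) (y' i) ≤ c * w i := fun i => by
    by_cases hi : i ∈ S
    · exact hc ⟨i, hi⟩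
    · rw [hx' i hi, hy' i hi, dist_self]
      exact mul_nonneg hc0 (hw i).le
  have hk : ∀ k i, dist ((N.updateOff S)^[k] x' i) ((N.updateOff S)^[k] y' i) ≤ c * w i := by
    intro k
    induction k with
    | zero => exact h0
    | succ k ih =>
      intro i
      rw [Function.iterate_succ_apply', Function.iterate_succ_apply']
      by_cases hi : i ∈ S
      · simpa only [updateOff, if_pos hi] using ih i
      · simp only [updateOff, if_neg hi]
        refine (h _ _ c ih i).trans (mul_le_of_le_one_left ?_ hr1.le)
        exact mul_nonneg hc0 (hw i).le
  exact h _ _ c (hk _) j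

/-! ### Trajectories of the network and delayed variables of the restriction -/

/-- Beyond `substIter_walk`, this keeps track of the endpoint `j`, so that prepending a vertex of
`S` yields a branch of known length. -/
theorem exists_walk_of_mem_vars_substIter (N : DynamicalNetwork X) (S : Finset ι) (j : ι)
    (k : ℕ) : ∀ i ∈ (N.substIter S j k).vars, i ∉ S →
      ∃ l : List ι, (i :: (l ++ [j])).IsChain N.graph.Adj ∧ l.length = k ∧ ∀ v ∈ l, v ∉ S := by
  induction k with
  | zero => exact fun i hi _ => ⟨[], List.isChain_pair.2 hi, rfl, by simp⟩
  | succ k ih =>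
    intro i hi hiS
    obtain ⟨m, hm, him⟩ := (N.mem_vars_substIter_succ S j k i).1 hi
    by_cases h : m ∈ S
    · rw [if_pos h] at him
      exact absurd (him ▸ h) hiS
    · rw [if_neg h] at him
      obtain ⟨l, h1, h2, h3⟩ := ih m hm h
      exact ⟨m :: l, List.isChain_cons_cons.2 ⟨him, h1⟩, by simp [h2],
        List.forall_mem_cons.2 ⟨h, h3⟩⟩

/-- Each substitution moves the variables outside `S` one time step back, while a variable in `S`
stays frozen at the time when it appeared, namely `t` minus the length of its branch. The bound `k +
1 ≤ t` keeps the subtraction from truncating. -/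
theorem map_iterate_eq_eval_substIter (N : DynamicalNetwork X) {S : Finset ι}
    (hS : N.graph.IsBasicStructuralSet S) {j : ι} (hj : j ∈ S) (x : ∀ i, X i) (k t : ℕ)
    (ht : k + 1 ≤ t) :
    N.map^[t] x j = (N.substIter S j k).eval fun i =>
      N.map^[if i ∈ S then t - N.graph.branchLength S i j else t - (k + 1)] x i := by
  induction k with
  | zero =>
    obtain ⟨t, rfl⟩ := Nat.exists_eq_add_of_le' ht
    rw [Function.iterate_succ_apply']
    refine (N.component j).eval_congr fun i hi => ?_
    split_ifs with h
    · rw [hS.branchLength_eq h hj (hS.complete.mem_branches h hj (l := []) (by simp)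
        (List.isChain_pair.2 hi))]
      simp
    · simp
  | succ k ih =>
    rw [ih (by omega), substIter_succ, eval_subst]
    refine VarFun.eval_congr _ fun i hi => ?_
    by_cases h : i ∈ S
    · simp only [updateOff, if_pos h]
    · simp only [updateOff, if_neg h]
      rw [show t - (k + 1) = t - (k + 1 + 1) + 1 by omega, Function.iterate_succ_apply']
      rw [← eval_component, ← eval_component]
      refine VarFun.eval_congr _ fun m hm => ?_
      split_ifs with hmS
      -- The branch `m, i, l, j` has `k + 2` edges, matching the time `t - (k + 2)`.
      · obtain ⟨l, h1, h2, h3⟩ := N.exists_walk_of_mem_vars_substIter S j k i hi h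
        rw [hS.branchLength_eq hmS hj (hS.complete.mem_branches hmS hj (l := i :: l)
          (List.forall_mem_cons.2 ⟨h, h3⟩) (List.isChain_cons_cons.2 ⟨hm, h1⟩))]
        simp [h2]
      · rfl

theorem map_iterate_eq_restriction_map [Fintype ι] (N : DynamicalNetwork X) {S : Finset ι}
    (hS : N.graph.IsBasicStructuralSet S) :
    ∃ T : ℕ, ∀ (j : {i // i ∈ S}) (x : ∀ i, X i) (t : ℕ), T ≤ t →
      N.map^[t] x j = (N.restriction S hS.complete).map
        (fun i => N.map^[t - N.graph.branchLength S i j] x i) j := by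
  obtain ⟨T, hT⟩ := Finite.exists_le fun j : {i // i ∈ S} =>
    Nat.find (N.exists_substIter_vars_subset S hS.complete j) + 1
  refine ⟨T, fun j x t ht => ?_⟩
  rw [N.restriction_map_apply hS.complete (fun i => N.map^[t - N.graph.branchLength S i j] x i),
    N.map_iterate_eq_eval_substIter hS j.2 x _ t ((hT j).trans ht)]
  refine VarFun.eval_congr _ fun i hi => ?_
  rw [if_pos (N.restrictionComponent_vars_subset S hS.complete j hi)]

theorem tendsto_iterate_of_restriction [Fintype ι] (N : DynamicalNetwork X) {S : Finset ι}
    (hS : N.graph.IsBasicStructuralSet S) {w : {i // i ∈ S} → ℝ} {r : ℝ} (hw : ∀ i, 0 < w i)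
    (hr0 : 0 < r) (hr1 : r < 1)
    (h : IsWeightedContraction (N.restriction S hS.complete).map w r)
    {p : ∀ i : {i // i ∈ S}, X i} (hp : (N.restriction S hS.complete).map p = p)
    (x : ∀ i, X i) (j : {i // i ∈ S}) :
    Tendsto (fun t => N.map^[t] x j) atTop (𝓝 (p j)) := by
  obtain ⟨T, hT⟩ := N.map_iterate_eq_restriction_map hS
  obtain ⟨D, hD⟩ := Finite.exists_le fun q : {i // i ∈ S} × {i // i ∈ S} =>
    N.graph.branchLength S q.1 q.2
  have hstep : ∀ (t : ℕ) (c : ℝ) (j : {i // i ∈ S}), T ≤ t →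
      (∀ i : {i // i ∈ S},
        dist (N.map^[t - N.graph.branchLength S i j] x i) (p i) ≤ c * w i) →
      dist (N.map^[t] x j) (p j) ≤ r * (c * w j) := by
    intro t c j ht hc
    rw [hT j x t ht]
    conv_lhs => rw [← hp]
    exact h _ _ c hc j
  -- With `T + 1` time `0` is always included: this forces `c ≥ 0`, and the remaining times are
  -- positive, as a strict decrease under the delays requires.
  obtain ⟨c, hc⟩ : ∃ c : ℝ, ∀ t < T + 1, ∀ i : {i // i ∈ S},
      dist (N.map^[t] x i) (p i) ≤ c * w i := by
    obtain ⟨c, hc⟩ := Finite.exists_le fun q : Fin (T + 1) × {i // i ∈ S} =>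
      dist (N.map^[(q.1 : ℕ)] x q.2) (p q.2) / w q.2
    exact ⟨c, fun t ht i => (div_le_iff₀ (hw i)).1 (hc (⟨t, ht⟩, i))⟩
  have hc0 : 0 ≤ c :=
    nonneg_of_mul_nonneg_left (dist_nonneg.trans (hc 0 (by omega) j)) (hw j)
  have hbdd : ∀ t, ∀ i : {i // i ∈ S}, dist (N.map^[t] x i) (p i) ≤ c * w i := by
    intro t
    induction t using Nat.strong_induction_on with
    | _ t ih =>
      intro i
      by_cases ht : t < T + 1
      · exact hc t ht i
      · refine (hstep t c i (by omega) fun m => ih _ ?_ m).trans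
          (mul_le_of_le_one_left (mul_nonneg hc0 (hw i).le) hr1.le)
        have := N.graph.branchLength_pos (S := S) m i
        omega
  -- After a further `T + D` steps all delayed times are past the previous `t₀`, and one more factor
  -- `r` is gained.
  have hdecay : ∀ n : ℕ, ∃ t₀, ∀ t ≥ t₀, ∀ i : {i // i ∈ S},
      dist (N.map^[t] x i) (p i) ≤ c * r ^ n * w i := by
    intro n
    induction n with
    | zero => exact ⟨0, fun t _ i => by simpa using hbdd t i⟩
    | succ n ih =>
      obtain ⟨t₀, ht₀⟩ := ih
      refine ⟨T + t₀ + D, fun t ht i =>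
        (hstep t (c * r ^ n) i (by omega) fun m => ht₀ _ ?_ m).trans_eq (by ring)⟩
      have := hD (m, i)
      dsimp only at this
      omega
  refine Metric.tendsto_atTop.2 fun ε hε => ?_
  have hlim : Tendsto (fun n => c * r ^ n * w j) atTop (𝓝 0) := by
    simpa using ((tendsto_pow_atTop_nhds_zero_of_lt_one hr0.le hr1).const_mul c).mul_const (w j)
  obtain ⟨n, hn⟩ := (hlim.eventually (gt_mem_nhds hε)).exists
  obtain ⟨t₀, ht₀⟩ := hdecay n
  exact ⟨t₀, fun t ht => (ht₀ t ht j).trans_lt hn⟩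

/-- If all trajectories converge to common limits in the coordinates of a structural set, then they
do so in every coordinate. -/
theorem exists_tendsto_iterate [Fintype ι] [∀ i, Nonempty (X i)] (N : DynamicalNetwork X)
    {S : Finset ι} (hS : N.graph.IsCompleteStructuralSet S)
    (h : ∀ i ∈ S, ∃ q : X i, ∀ x, Tendsto (fun t => N.map^[t] x i) atTop (𝓝 q)) (j : ι) :
    ∃ q : X j, ∀ x, Tendsto (fun t => N.map^[t] x j) atTop (𝓝 q) := by
  have hstep : ∀ l, (∀ i ∈ N.I l, ∃ q : X i, ∀ x,
      Tendsto (fun t => N.map^[t] x i) atTop (𝓝 q)) →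
      ∃ q : X l, ∀ x, Tendsto (fun t => N.map^[t] x l) atTop (𝓝 q) := by
    intro l hl
    choose q hq using fun i : N.I l => hl i i.2
    refine ⟨(N.component l).toFun q, fun x => (tendsto_add_atTop_iff_nat 1).1 ?_⟩
    simp_rw [Function.iterate_succ_apply']
    exact ((N.component l).continuous_toFun.tendsto q).comp
      (tendsto_pi_nhds.2 fun i => hq i x)
  -- Induction undoes substitutions: convergence of the variables of `𝓕_(j,k+1)` gives that of the
  -- variables of `𝓕_(j,k)`.
  have hback : ∀ k, (∀ i ∈ (N.substIter S j k).vars, ∃ q : X i, ∀ x,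
      Tendsto (fun t => N.map^[t] x i) atTop (𝓝 q)) →
      ∃ q : X j, ∀ x, Tendsto (fun t => N.map^[t] x j) atTop (𝓝 q) := by
    intro k
    induction k with
    | zero => exact hstep j
    | succ k ih =>
      refine fun hk => ih fun l hl => ?_
      by_cases hlS : l ∈ S
      · exact h l hlS
      · exact hstep l fun i hi =>
          hk i ((N.mem_vars_substIter_succ S j k i).2 ⟨l, hl, by rwa [if_neg hlS]⟩)
  obtain ⟨k, hk⟩ := N.exists_substIter_vars_subset S hS j
  exact hback k fun i hi => h i (hk hi)

theorem isGloballyStable_of_restriction [Fintype ι] [∀ i, Nonempty (X i)]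
    (N : DynamicalNetwork X) {S : Finset ι} (hS : N.graph.IsCompleteStructuralSet S)
    (h : ∀ i ∈ S, ∃ q : X i, ∀ x, Tendsto (fun t => N.map^[t] x i) atTop (𝓝 q)) :
    N.IsGloballyStable := by
  choose q hq using N.exists_tendsto_iterate hS h
  have hlim : ∀ x, Tendsto (fun t => N.map^[t] x) atTop (𝓝 q) := fun x =>
    tendsto_pi_nhds.2 fun i => hq i x
  refine ⟨q, ?_, fun x => tendsto_iff_dist_tendsto_zero.1 (hlim x)⟩
  let x : ∀ i, X i := fun i => Classical.arbitrary (X i)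
  have h1 : Tendsto (fun t => N.map^[t + 1] x) atTop (𝓝 (N.map q)) := by
    simp_rw [Function.iterate_succ_apply']
    exact (N.continuous_map.tendsto q).comp (hlim x)
  exact tendsto_nhds_unique h1 ((tendsto_add_atTop_iff_nat 1).2 (hlim x))

end DynamicalNetwork

theorem theorem6p4 {ι : Type*} [Fintype ι] [DecidableEq ι] {X : ι → Type*}
    [∀ i, MetricSpace (X i)] [∀ i, CompleteSpace (X i)] [∀ i, Nonempty (X i)]
    (N : DynamicalNetwork X) (S : Finset ι) (hS : N.graph.IsBasicStructuralSet S) :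
    ((∃ A : Matrix ι ι ℝ, N.IsStabilityMatrix A ∧ A.complexSpectralRadius < 1) →
      (N.restriction S hS.complete).IsGloballyStable) ∧
    ((∃ B : Matrix {i // i ∈ S} {i // i ∈ S} ℝ,
        (N.restriction S hS.complete).IsStabilityMatrix B ∧ B.complexSpectralRadius < 1) →
      N.IsGloballyStable) := by
  constructor
  · rintro ⟨A, hA, hρ⟩
    obtain ⟨w, r, hw, hr0, hr1, h⟩ := hA.exists_isWeightedContraction hρ
    exact (N.restriction S hS.complete).isGloballyStable_of_isWeightedContraction
      (fun i => hw i) hr0 hr1 (N.isWeightedContraction_restriction hS.complete hw hr1 h)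
  · rintro ⟨B, hB, hρ⟩
    obtain ⟨w, r, hw, hr0, hr1, h⟩ := hB.exists_isWeightedContraction hρ
    obtain ⟨p, hp⟩ := h.exists_fixedPoint hw hr0 hr1
    exact N.isGloballyStable_of_restriction hS.complete fun i hi => ⟨p ⟨i, hi⟩, fun x =>
      N.tendsto_iterate_of_restriction hS hw hr0 hr1 h hp x ⟨i, hi⟩⟩
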